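/- For a finite graph $G$, let $F_2(G)$ denote its $2$-token graph: its vertices are the $2$-element subsets of $V(G)$, and two of them are adjacent when one is obtained from the other by moving one element along an edge of $G$. Let $C_n$ ($n\ge 2$, with $C_2=K_2$) be the cycle on $\mathbb Z_n$, with $i$ adjacent to $i\pm1$. For $p\ge 0$, the $p$-augmented $2$-token graph $F_2^p(C_n)$ is obtained from $F_2(C_n)$, whose vertices $\{i,i+1\}$ are also written $\{i,i+1\}^0$, by adding, on each level $\ell=1,\dots,p$, $n$ new vertices indexed by $i\in\mathbb Z_n$, denoted $\{i,i\}^\ell$ if $\ell$ is odd and $\{i,i+1\}^\ell$ if $\ell$ is even (for $n=2$ and even $\ell\ge 2$, the vertices indexed by $i=0$ and $i=1$ are counted as two distinct vertices, so that there are always $\binom n2+pn$ vertices), together with the edges $$\{i,i\}^\ell\sim\{i,i+1\}^{\ell-1},\ \{i-1,i\}^{\ell-1}\quad(\ell \text{ odd}),\qquad \{i,i+1\}^\ell\sim\{i,i\}^{\ell-1},\ \{i+1,i+1\}^{\ell-1}\quad(\ell\ge2 \text{ even}).$$ **Theorem.** For all integers $n\ge 2$ and $p\ge 0$, the independence number $\alpha=\alpha(F_2^p(C_n))$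 is as follows. - If $n=4r$, then $\alpha=\left(r+\frac p2\right)n$ for every $p$, even or odd. In particular $\alpha=4r^2$ for $p=0$, and $\alpha=4r^2+2r=r(n+2)$ for $p=1$. - If $n=4r+1$, then $\alpha=\left(r+\frac p2\right)n$ for even $p$, and $\alpha=\left(r+\frac p2\right)n-\frac12$ for odd $p$. In particular $\alpha=4r^2+r$ for $p=0$, and $\alpha=4r^2+3r=r(n+2)$ for $p=1$. - If $n=4r+2$, then $\alpha=\left(r+\frac p2+\frac12\right)n$ for every $p$, even or odd. In particular $\alpha=(2r+1)^2$ for $p=0$, and $\alpha=4r^2+6r+2=(r+1)n$ for $p=1$. - If $n=4r+3$, then $\alpha=\left(r+\frac p2+\frac12\right)n-\frac12$ for even $p$, and $\alpha=\left(r+\frac p2+\frac12\right)n$ for odd $p$. In particular $\alpha=4r^2+5r+1$ for $p=0$, and $\alpha=4r^2+7r+3=(r+1)n$ for $p=1$. Moreover, for $p=0$, in all four cases $\alpha=\left\lfloor \frac{n\lfloor n/2\rfloor}{2}\right\rfloor$. -/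

import Mathlib

/-- The `k`-token graph of `G`. Its vertices are the `k`-subsets of the vertex set of `G`, and two
of them are adjacent when one is obtained from the other by moving one token along an edge of `G`. -/
def tokenGraph {V : Type*} [DecidableEq V] (G : SimpleGraph V) (k : ℕ) :
    SimpleGraph {S : Finset V // S.card = k} where
  Adj S T := ∃ a b, G.Adj a b ∧ S.1 \ T.1 = {a} ∧ T.1 \ S.1 = {b}
  symm := by
    constructor
    rintro S T ⟨a, b, hab, h₁, h₂⟩
    exact ⟨b, a, hab.symm, h₂, h₁⟩
  loopless := by
    constructor
    rintro S ⟨a, b, _, h₁, _⟩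
    simp at h₁

/-- The vertices of the `p`-augmented 2-token graph of the `n`-cycle: the 2-subsets of `Fin n`
(the vertices of the 2-token graph), together with `n` vertices on each of the levels `1, …, p`.
The vertex `Sum.inr (i, k)` lies on level `ℓ = k + 1`; it is `{i, i}^ℓ` if `ℓ` is odd, and
`{i, i + 1}^ℓ` if `ℓ` is even. -/
abbrev AugmentedVertex (n p : ℕ) : Type :=
  {S : Finset (Fin n) // S.card = 2} ⊕ (Fin n × Fin p)

/-- The edges of the `p`-augmented 2-token graph of the `n`-cycle, each new edge being directed
from its higher level to its lower level (the vertices of the 2-token graph `{i, i + 1}` have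
level `0`; indices are taken modulo `n`):
* the edges of the 2-token graph;
* `{i, i}^ℓ ∼ {i, i + 1}^(ℓ - 1), {i, i - 1}^(ℓ - 1)` for odd `ℓ`;
* `{i, i + 1}^ℓ ∼ {i, i}^(ℓ - 1), {i + 1, i + 1}^(ℓ - 1)` for even `ℓ ≥ 2`. -/
def augmentedRel (n p : ℕ) [NeZero n] : AugmentedVertex n p → AugmentedVertex n p → Prop
  | Sum.inl S, Sum.inl T => (tokenGraph (SimpleGraph.cycleGraph n) 2).Adj S T
  | Sum.inr (i, k), Sum.inl S => (k : ℕ) = 0 ∧ (S.1 = {i, i + 1} ∨ S.1 = {i, i - 1})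
  | Sum.inr (i, k), Sum.inr (j, l) =>
      (k : ℕ) = (l : ℕ) + 1 ∧
        ((Odd ((k : ℕ) + 1) ∧ (j = i ∨ j = i - 1)) ∨ (Even ((k : ℕ) + 1) ∧ (j = i ∨ j = i + 1)))
  | Sum.inl _, Sum.inr _ => False

/-- The `p`-augmented 2-token graph `F_2^p(C_n)` of the cycle `C_n`. -/
def augmentedTokenGraph (n p : ℕ) [NeZero n] : SimpleGraph (AugmentedVertex n p) :=
  SimpleGraph.fromRel (augmentedRel n p)

/-! All cases come from one formula: the independence number is `R * n / 2`, rounded down, with `R =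
n / 2 + p` (`indepNum_augmentedTokenGraph`). The vertices form `R` rows of `n` entries: the levels
from `p` down to `1`, then the pairs at cyclic distance `1, …, n / 2`. For even `n` the last row
lists each antipodal pair twice, so it has only `n / 2` vertices.

Upper bound: equal indices match consecutive rows, so an independent set has at most `n` vertices in
two consecutive rows. It has at most `n / 2` in the last row: by size for even `n`, and for odd `n`
because that row contains a cycle through all its vertices.

Lower bound: edges join consecutive rows, except those inside the last row for odd `n`. So the rows
of even index, with the last one cut down to `i < n / 2`, form an independent set of the required
size. -/

/-! ### Sums over rows -/

/-- Rows are paired from the start; for odd `R` the last one is left over and `htop` bounds it. -/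
theorem two_mul_sum_range_le {n R : ℕ} {a : ℕ → ℕ} (hR : 0 < R)
    (h : ∀ k, k + 1 < R → a k + a (k + 1) ≤ n) (htop : 2 * a (R - 1) ≤ n) :
    2 * ∑ k ∈ Finset.range R, a k ≤ R * n := by
  have key : ∀ q, 2 * q ≤ R → ∑ k ∈ Finset.range (2 * q), a k ≤ q * n := by
    intro q
    induction q with
    | zero => simp
    | succ q ih =>
      intro hq
      have h₁ := ih (by omega)
      have h₂ := h (2 * q) (by omega)
      rw [show 2 * (q + 1) = 2 * q + 1 + 1 by ring, Finset.sum_range_succ, Finset.sum_range_succ,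
        add_mul]
      omega
  obtain ⟨q, rfl | rfl⟩ := R.even_or_odd'
  · have := key q le_rfl
    rw [mul_assoc]
    omega
  · have := key q (by omega)
    rw [Finset.sum_range_succ, add_mul, mul_assoc]
    simp only [Nat.add_sub_cancel] at htop
    omega

theorem sum_range_ite_even (n m R : ℕ) (hm : m = n / 2) :
    ∑ k ∈ Finset.range R, (if Even k then (if k + 1 = R then m else n) else 0) = R * n / 2 := by
  have key : ∀ q, ∀ R ≥ 2 * q, ∑ k ∈ Finset.range (2 * q),
      (if Even k then (if k + 1 = R then m else n) else 0) = q * n := by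
    intro q
    induction q with
    | zero => simp
    | succ q ih =>
      intro R hR
      rw [show 2 * (q + 1) = 2 * q + 1 + 1 by ring, Finset.sum_range_succ, Finset.sum_range_succ,
        ih R (by omega), if_pos (by simp), if_neg (by omega), if_neg (by simp)]
      ring
  obtain ⟨q, rfl | rfl⟩ := R.even_or_odd'
  · rw [key q _ le_rfl, mul_assoc]
    omega
  · rw [Finset.sum_range_succ, key q _ (by omega), if_pos (by simp), if_pos rfl, add_mul, mul_assoc]
    omega

/-! ### Adjacency in cycles and token graphs -/

theorem cycleGraph_adj_iff_val {n : ℕ} (hn : 2 ≤ n) (u v : Fin n) :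
    (SimpleGraph.cycleGraph n).Adj u v ↔
      v.val = (u.val + 1) % n ∨ u.val = (v.val + 1) % n := by
  rw [SimpleGraph.cycleGraph_adj', Fin.sub_def, Fin.sub_def]
  obtain ⟨u, hu⟩ := u
  obtain ⟨v, hv⟩ := v
  simp only [Nat.add_mod_eq_ite, Nat.mod_eq_of_lt hu, Nat.mod_eq_of_lt hv,
    Nat.mod_eq_of_lt (show 1 < n by omega)]
  have h1 : (n - v) % n = if v = 0 then 0 else n - v := by
    split_ifs with h
    · simp [h]
    · exact Nat.mod_eq_of_lt (by omega)
  have h2 : (n - u) % n = if u = 0 then 0 else n - u := by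
    split_ifs with h
    · simp [h]
    · exact Nat.mod_eq_of_lt (by omega)
  rw [h1, h2]
  split_ifs <;> omega

theorem val_eq_cases_of_cycleGraph_adj {n : ℕ} (hn : 2 ≤ n) {u v : Fin n}
    (h : (SimpleGraph.cycleGraph n).Adj u v) :
    v.val = u.val + 1 ∨ u.val = v.val + 1 ∨ (u.val = 0 ∧ v.val + 1 = n) ∨
      (v.val = 0 ∧ u.val + 1 = n) := by
  rw [cycleGraph_adj_iff_val hn] at h
  have hu := u.isLt
  have hv := v.isLt
  simp only [Nat.add_mod_eq_ite, Nat.mod_eq_of_lt hu, Nat.mod_eq_of_lt hv,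
    Nat.mod_eq_of_lt (show 1 < n by omega)] at h
  split_ifs at h <;> omega

theorem tokenGraph_adj_of_common {V : Type*} [DecidableEq V] {G : SimpleGraph V} {x y z : V}
    (hy : x ≠ y) (hz : x ≠ z) (h : G.Adj y z) {S T : {S : Finset V // S.card = 2}}
    (hS : S.1 = {x, y}) (hT : T.1 = {x, z}) : (tokenGraph G 2).Adj S T := by
  refine ⟨y, z, h, ?_, ?_⟩ <;> rw [hS, hT] <;> ext t <;> have := h.ne <;>
    simp only [Finset.mem_sdiff, Finset.mem_insert, Finset.mem_singleton] <;> grind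

theorem exists_common_of_tokenGraph_adj {V : Type*} [DecidableEq V] {G : SimpleGraph V}
    {x y z w : V} {S T : {S : Finset V // S.card = 2}} (hS : S.1 = {x, y}) (hT : T.1 = {z, w})
    (hxy : x ≠ y) (hzw : z ≠ w) (h : (tokenGraph G 2).Adj S T) :
    (x = z ∧ G.Adj y w) ∨ (x = w ∧ G.Adj y z) ∨ (y = z ∧ G.Adj x w) ∨ (y = w ∧ G.Adj x z) := by
  obtain ⟨a, b, hab, h₁, h₂⟩ := h
  rw [hS, hT, Finset.ext_iff] at h₁ h₂
  simp only [Finset.mem_sdiff, Finset.mem_insert, Finset.mem_singleton] at h₁ h₂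
  have := h₁ x
  have := h₁ y
  have := h₁ a
  have := h₂ z
  have := h₂ w
  have := h₂ b
  grind

theorem pair_eq_pair_cases {V : Type*} [DecidableEq V] {x y z w : V}
    (h : ({x, y} : Finset V) = {z, w}) : (x = z ∧ y = w) ∨ (x = w ∧ y = z) := by
  have := Finset.ext_iff.1 h
  simp only [Finset.mem_insert, Finset.mem_singleton] at this
  have hx := this x
  have hy := this y
  have hz := this z
  have hw := this w
  grind

/-! ### The arrangement in rows -/

/-- The residue `i + d` modulo `n`. -/
def cyclicShift {n : ℕ} (i : Fin n) (d : ℕ) : Fin n :=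
  ⟨(i.val + d) % n, Nat.mod_lt _ (by have := i.isLt; omega)⟩

theorem cyclicShift_val {n : ℕ} (i : Fin n) {d : ℕ} (hd : d < n) :
    (cyclicShift i d).val = if i.val + d < n then i.val + d else i.val + d - n := by
  have := i.isLt
  simp only [cyclicShift, Nat.add_mod_eq_ite, Nat.mod_eq_of_lt this, Nat.mod_eq_of_lt hd]
  split_ifs <;> omega

theorem ne_cyclicShift {n : ℕ} (i : Fin n) {d : ℕ} (hd : d < n) (h0 : 0 < d) :
    i ≠ cyclicShift i d := by
  intro h
  have h₁ := congrArg Fin.val h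
  have := i.isLt
  rw [cyclicShift_val i hd] at h₁
  split_ifs at h₁ <;> omega

/-- The vertices of `F_2^p(C_n)` arranged in `n / 2 + p` rows of `n` entries: the first `p` rows are
the levels `p, …, 1`, and the row `p + d - 1` consists of the pairs `{i, i + d}`. -/
def rowVertex {n p : ℕ} (i : Fin n) (k : Fin (n / 2 + p)) : AugmentedVertex n p :=
  if h : k.val < p then Sum.inr (i, ⟨p - 1 - k.val, by omega⟩)
  else Sum.inl ⟨{i, cyclicShift i (k.val - p + 1)}, Finset.card_pair
    (ne_cyclicShift i (by have := k.isLt; have := i.isLt; omega) (by omega))⟩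

theorem val_add_one_fin {n : ℕ} [NeZero n] (i : Fin n) :
    (i + 1).val = (i.val + 1) % n := by
  rw [Fin.val_add, Fin.val_one', Nat.add_mod_mod]

theorem add_one_eq_cyclicShift {n : ℕ} [NeZero n] (i : Fin n) : i + 1 = cyclicShift i 1 := by
  ext
  rw [val_add_one_fin, cyclicShift]

theorem rowVertex_adj_succ {n p : ℕ} [NeZero n] (hn : 2 ≤ n) (i : Fin n) (k : ℕ)
    (hk : k + 1 < n / 2 + p) :
    (augmentedTokenGraph n p).Adj (rowVertex i ⟨k, by omega⟩) (rowVertex i ⟨k + 1, hk⟩) := by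
  rw [augmentedTokenGraph, SimpleGraph.fromRel_adj]
  have hi := i.isLt
  rcases lt_trichotomy (k + 1) p with h | h | h
  · rw [rowVertex, rowVertex, dif_pos (show k < p by omega), dif_pos (show k + 1 < p by omega)]
    refine ⟨fun e => ?_, Or.inl ⟨by simp only; omega, ?_⟩⟩
    · simp at e; omega
    · rcases Nat.even_or_odd (p - 1 - k + 1) with h | h
      · exact Or.inr ⟨h, Or.inl rfl⟩
      · exact Or.inl ⟨h, Or.inl rfl⟩
  · rw [rowVertex, rowVertex, dif_pos (show k < p by omega), dif_neg (show ¬ k + 1 < p by omega)]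
    refine ⟨by simp, Or.inl ⟨by simp only; omega, Or.inl ?_⟩⟩
    simp only [add_one_eq_cyclicShift, h, Nat.sub_self]
  · rw [rowVertex, rowVertex, dif_neg (show ¬ k < p by omega), dif_neg (show ¬ k + 1 < p by omega)]
    have h₁ : (tokenGraph (SimpleGraph.cycleGraph n) 2).Adj
        ⟨{i, cyclicShift i (k - p + 1)}, Finset.card_pair
          (ne_cyclicShift i (by omega) (by omega))⟩
        ⟨{i, cyclicShift i (k + 1 - p + 1)}, Finset.card_pair
          (ne_cyclicShift i (by omega) (by omega))⟩ := by
      refine tokenGraph_adj_of_common (ne_cyclicShift i (by omega) (by omega))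
        (ne_cyclicShift i (by omega) (by omega)) ?_ rfl rfl
      rw [cycleGraph_adj_iff_val hn]
      left
      simp only [cyclicShift, Nat.mod_add_mod]
      congr 1
      omega
    exact ⟨fun e => h₁.ne (Sum.inl_injective e), Or.inl h₁⟩

/-- For `n = 2m + 1`, moving `i + m` to `i + m + 1` turns `{i, i + m}` into a pair again at distance
`m`, now starting at `i + m + 1`. -/
theorem rowVertex_adj_top {n p : ℕ} [NeZero n] (hn : 2 ≤ n) (hodd : Odd n) (i : Fin n)
    (k : ℕ) (hk : k + 1 = n / 2 + p) :
    (augmentedTokenGraph n p).Adj (rowVertex i ⟨k, by omega⟩)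
      (rowVertex (cyclicShift i (n / 2 + 1)) ⟨k, by omega⟩) := by
  rw [augmentedTokenGraph, SimpleGraph.fromRel_adj]
  have hi := i.isLt
  obtain ⟨m, hm⟩ := hodd
  rw [rowVertex, rowVertex, dif_neg (show ¬ k < p by omega), dif_neg (show ¬ k < p by omega)]
  have h₁ : (tokenGraph (SimpleGraph.cycleGraph n) 2).Adj
      ⟨{i, cyclicShift i (k - p + 1)}, Finset.card_pair
        (ne_cyclicShift i (by omega) (by omega))⟩
      ⟨{cyclicShift i (n / 2 + 1), cyclicShift (cyclicShift i (n / 2 + 1)) (k - p + 1)},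
        Finset.card_pair (ne_cyclicShift _ (by omega) (by omega))⟩ := by
    have h₂ : cyclicShift (cyclicShift i (n / 2 + 1)) (k - p + 1) = i := by
      ext
      simp only [cyclicShift, Nat.mod_add_mod]
      rw [show i.val + (n / 2 + 1) + (k - p + 1) = i.val + n by omega, Nat.add_mod_right,
        Nat.mod_eq_of_lt hi]
    refine tokenGraph_adj_of_common (x := i) (y := cyclicShift i (k - p + 1))
      (z := cyclicShift i (n / 2 + 1)) (ne_cyclicShift i (by omega) (by omega))
      (ne_cyclicShift i (by omega) (by omega)) ?_ rfl ?_
    · rw [cycleGraph_adj_iff_val hn]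
      left
      simp only [cyclicShift, Nat.mod_add_mod]
      congr 1
      omega
    · simp only [h₂]
      exact Finset.pair_comm _ _
  exact ⟨fun e => h₁.ne (Sum.inl_injective e), Or.inl h₁⟩

theorem exists_rowVertex_eq {n p : ℕ} (hn : 2 ≤ n) (v : AugmentedVertex n p) :
    ∃ i k, (Even n → k.val + 1 = n / 2 + p → i.val < n / 2) ∧ rowVertex i k = v := by
  rcases v with ⟨S, hS⟩ | ⟨i, l⟩
  · obtain ⟨a, b, hab, rfl⟩ : ∃ a b : Fin n, a < b ∧ S = {a, b} := by
      obtain ⟨a, b, hab, rfl⟩ := Finset.card_eq_two.1 hS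
      rcases lt_or_gt_of_ne hab with h | h
      · exact ⟨a, b, h, rfl⟩
      · exact ⟨b, a, h, Finset.pair_comm _ _⟩
    have hab' : a.val < b.val := hab
    have ha := a.isLt
    have hb := b.isLt
    -- The pair is read along its shorter arc; an antipodal tie starts at the smaller element, which
    -- is below `n / 2`.
    by_cases h : b.val - a.val ≤ n / 2
    · refine ⟨a, ⟨b.val - a.val - 1 + p, by omega⟩, fun ⟨c, hc⟩ h' => by
        simp only at h'; omega, ?_⟩
      rw [rowVertex, dif_neg (by simp)]
      congr 3
      simp only [Nat.add_sub_cancel]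
      rw [show b.val - a.val - 1 + 1 = b.val - a.val by omega]
      have : cyclicShift a (b.val - a.val) = b := by
        ext
        rw [cyclicShift_val a (by omega)]
        split_ifs <;> omega
      rw [this]
    · refine ⟨b, ⟨n - (b.val - a.val) - 1 + p, by omega⟩, fun ⟨c, hc⟩ h' => by
        simp only at h'; omega, ?_⟩
      rw [rowVertex, dif_neg (by simp)]
      congr 2
      simp only [Nat.add_sub_cancel]
      rw [show n - (b.val - a.val) - 1 + 1 = n - (b.val - a.val) by omega]
      have : cyclicShift b (n - (b.val - a.val)) = a := by
        ext
        rw [cyclicShift_val b (by omega)]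
        split_ifs <;> omega
      rw [this, Finset.pair_comm]
  · have := l.isLt
    have := i.isLt
    refine ⟨i, ⟨p - 1 - l.val, by omega⟩, fun _ h => by simp only at h; omega, ?_⟩
    rw [rowVertex, dif_pos (by simp only; omega)]
    congr 2
    ext
    simp only
    omega

/-! ### Upper bound -/

theorem two_mul_card_le_of_isIndepSet {n p : ℕ} [NeZero n] (hn : 2 ≤ n)
    {S : Finset (AugmentedVertex n p)} (hS : (augmentedTokenGraph n p).IsIndepSet S) :
    2 * S.card ≤ (n / 2 + p) * n := by
  classical
  have hind : ∀ u v, (augmentedTokenGraph n p).Adj u v → u ∈ S → v ∈ S → False :=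
    fun u v h hu hv => hS hu hv h.ne h
  -- The indices of `S` in row `k`, with the repeated half of the last row dropped for even `n`.
  let A : ℕ → Finset (Fin n) := fun k => {i | (Even n → k + 1 = n / 2 + p → i.val < n / 2) ∧
    ∃ h : k < n / 2 + p, rowVertex i ⟨k, h⟩ ∈ S}
  have hcard : S.card ≤ ∑ k ∈ Finset.range (n / 2 + p), (A k).card := by
    rw [Finset.sum_range fun k => (A k).card, ← Finset.card_sigma]
    refine Finset.card_le_card_of_surjOn
      (fun x : (_ : Fin (n / 2 + p)) × Fin n => rowVertex x.2 x.1) ?_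
    intro v hv
    obtain ⟨i, k, hk, rfl⟩ := exists_rowVertex_eq hn v
    refine ⟨⟨k, i⟩, ?_, rfl⟩
    simp only [Finset.coe_sigma, Set.mem_sigma_iff, Finset.coe_univ, Set.mem_univ, true_and, A,
      Finset.mem_coe, Finset.mem_filter, Finset.mem_univ]
    exact ⟨hk, k.isLt, hv⟩
  have hdisj : ∀ B C : Finset (Fin n), Disjoint B C → B.card + C.card ≤ n := by
    intro B C h
    rw [← Finset.card_union_of_disjoint h]
    exact (Finset.card_le_univ _).trans_eq (Fintype.card_fin n)
  refine (Nat.mul_le_mul_left 2 hcard).trans (two_mul_sum_range_le (by omega) ?_ ?_)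
  · intro k hk
    refine hdisj _ _ (Finset.disjoint_left.2 fun i h₁ h₂ => ?_)
    simp only [A, Finset.mem_filter, Finset.mem_univ, true_and] at h₁ h₂
    exact hind _ _ (rowVertex_adj_succ hn i k hk) h₁.2.2 h₂.2.2
  · rcases Nat.even_or_odd n with he | ho
    · have : (A (n / 2 + p - 1)).card ≤ (Finset.range (n / 2)).card := by
        refine Finset.card_le_card_of_injOn Fin.val ?_ Fin.val_injective.injOn
        intro i hi
        simp only [A, Finset.coe_filter, Finset.mem_univ, true_and, Set.mem_ofPred_eq] at hi
        simpa using hi.1 he (by omega)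
      rw [Finset.card_range] at this
      omega
    · have hinj : Function.Injective fun i : Fin n => cyclicShift i (n / 2 + 1) := by
        obtain ⟨m, hm⟩ := ho
        intro i j h
        have h₁ := congrArg Fin.val h
        simp only [cyclicShift_val _ (show n / 2 + 1 < n by omega)] at h₁
        ext
        have := i.isLt
        have := j.isLt
        split_ifs at h₁ <;> omega
      -- The last row's index set is disjoint from its shift by `n / 2 + 1`, which has the same
      -- size.
      rw [two_mul]
      nth_rewrite 2 [← Finset.card_image_of_injective _ hinj]
      refine hdisj _ _ (Finset.disjoint_left.2 fun i h₁ h₂ => ?_)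
      obtain ⟨j, hj, rfl⟩ := Finset.mem_image.1 h₂
      simp only [A, Finset.mem_filter, Finset.mem_univ, true_and] at h₁ hj
      exact hind _ _ (rowVertex_adj_top hn ho j _ (by omega)) hj.2.2 h₁.2.2

/-! ### Lower bound -/

theorem rowVertex_inj {n p : ℕ} {i j : Fin n} {k l : Fin (n / 2 + p)}
    (hk : k.val + 1 = n / 2 + p → i.val < n / 2) (hl : l.val + 1 = n / 2 + p → j.val < n / 2)
    (h : rowVertex i k = rowVertex j l) : i = j ∧ k = l := by
  have hi := i.isLt
  have hj := j.isLt
  have hk' := k.isLt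
  have hl' := l.isLt
  unfold rowVertex at h
  split_ifs at h with h₁ h₂ h₂
  · simp only [Sum.inr.injEq, Prod.mk.injEq, Fin.mk.injEq] at h
    exact ⟨h.1, Fin.ext (by omega)⟩
  · simp only [Sum.inl.injEq, Subtype.mk.injEq] at h
    have h₃ := pair_eq_pair_cases h
    simp only [Fin.ext_iff] at h₃ ⊢
    rw [cyclicShift_val _ (by omega), cyclicShift_val _ (by omega)] at h₃
    split_ifs at h₃ <;> omega

theorem not_augmentedRel_rowVertex {n p : ℕ} [NeZero n] (hn : 2 ≤ n) {i j : Fin n}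
    {k l : Fin (n / 2 + p)} (hk : k.val + 1 = n / 2 + p → i.val < n / 2)
    (hl : l.val + 1 = n / 2 + p → j.val < n / 2) (hke : Even k.val) (hle : Even l.val) :
    ¬ augmentedRel n p (rowVertex i k) (rowVertex j l) := by
  intro h
  have hi := i.isLt
  have hj := j.isLt
  have hk' := k.isLt
  have hl' := l.isLt
  obtain ⟨a, ha⟩ := hke
  obtain ⟨b, hb⟩ := hle
  unfold rowVertex at h
  split_ifs at h with h₁ h₂ h₂
  · have := h.1
    simp only at this
    omega
  · obtain ⟨h₃, h₄⟩ := h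
    simp only at h₃ h₄
    have hsucc : ∀ u : Fin n, (SimpleGraph.cycleGraph n).Adj u (u + 1) := fun u =>
      (cycleGraph_adj_iff_val hn _ _).2 (Or.inl (val_add_one_fin u))
    have hpred : (SimpleGraph.cycleGraph n).Adj i (i - 1) := by
      simpa using (hsucc (i - 1)).symm
    -- A level-one vertex only meets pairs at distance `1`, which forces `l = p = k + 1`, against
    -- parity.
    have hadj : (SimpleGraph.cycleGraph n).Adj j (cyclicShift j (l.val - p + 1)) := by
      rcases h₄ with h₄ | h₄ <;> obtain ⟨e₁, e₂⟩ | ⟨e₁, e₂⟩ := pair_eq_pair_cases h₄ <;>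
        rw [e₂, e₁]
      exacts [hsucc i, (hsucc i).symm, hpred, hpred.symm]
    have h₅ := val_eq_cases_of_cycleGraph_adj hn hadj
    rw [cyclicShift_val _ (by omega)] at h₅
    split_ifs at h₅ <;> omega
  · exact h
  · have h₃ := exists_common_of_tokenGraph_adj rfl rfl (ne_cyclicShift i (by omega) (by omega))
      (ne_cyclicShift j (by omega) (by omega)) h
    have hval := cyclicShift_val i (show k.val - p + 1 < n by omega)
    have hval' := cyclicShift_val j (show l.val - p + 1 < n by omega)
    -- Adjacent pairs have distances differing by one, against parity, or are both at distance `(n -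
    -- 1) / 2` with `n` odd; then one starting point is at least `n / 2`.
    rcases h₃ with ⟨e, h₃⟩ | ⟨e, h₃⟩ | ⟨e, h₃⟩ | ⟨e, h₃⟩ <;>
    · have h₄ := val_eq_cases_of_cycleGraph_adj hn h₃
      have e' := congrArg Fin.val e
      split_ifs at hval hval' <;> omega

theorem indepNum_augmentedTokenGraph (n p : ℕ) [NeZero n] (hn : 2 ≤ n) :
    (augmentedTokenGraph n p).indepNum = (n / 2 + p) * n / 2 := by
  classical
  refine le_antisymm ?_ ?_
  · obtain ⟨S, hS⟩ := (augmentedTokenGraph n p).exists_isNIndepSet_indepNum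
    have := two_mul_card_le_of_isIndepSet hn hS.isIndepSet
    rw [hS.card_eq] at this
    omega
  · let A : Fin (n / 2 + p) → Finset (Fin n) := fun k =>
      {i | Even k.val ∧ (k.val + 1 = n / 2 + p → i.val < n / 2)}
    let J : Finset ((_ : Fin (n / 2 + p)) × Fin n) := Finset.univ.sigma A
    have hJ : ∀ x ∈ J, Even x.1.val ∧ (x.1.val + 1 = n / 2 + p → x.2.val < n / 2) := by
      intro x hx
      simpa [J, A] using hx
    have hA : ∀ k, (A k).card =
        if Even k.val then (if k.val + 1 = n / 2 + p then n / 2 else n) else 0 := by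
      intro k
      split_ifs with h₁ h₂
      · simp only [A, h₁, h₂, true_and, forall_const]
        rw [Fin.card_filter_val_lt]
        omega
      · simp [A, h₁, h₂]
      · simp [A, h₁]
    have hcard : J.card = (n / 2 + p) * n / 2 := by
      rw [Finset.card_sigma, ← sum_range_ite_even n (n / 2) _ rfl, Finset.sum_range]
      exact Finset.sum_congr rfl fun k _ => hA k
    rw [← hcard, ← Finset.card_image_of_injOn (s := J)
      (f := fun x : (_ : Fin (n / 2 + p)) × Fin n => (rowVertex x.2 x.1 : AugmentedVertex n p))]
    · apply SimpleGraph.IsIndepSet.card_le_indepNum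
      intro u hu v hv _ h
      simp only [Finset.coe_image, Set.mem_image, Finset.mem_coe] at hu hv
      obtain ⟨x, hx, rfl⟩ := hu
      obtain ⟨y, hy, rfl⟩ := hv
      rw [augmentedTokenGraph, SimpleGraph.fromRel_adj] at h
      have hx := hJ x hx
      have hy := hJ y hy
      rcases h.2 with h | h
      · exact not_augmentedRel_rowVertex hn hx.2 hy.2 hx.1 hy.1 h
      · exact not_augmentedRel_rowVertex hn hy.2 hx.2 hy.1 hx.1 h
    · rintro ⟨k, i⟩ hx ⟨l, j⟩ hy h
      obtain ⟨rfl, rfl⟩ := rowVertex_inj (hJ _ hx).2 (hJ _ hy).2 h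
      rfl

/-! ### The formula by residues modulo 4 -/

theorem mainTheorem6 (n p : ℕ) [NeZero n] (hn : 2 ≤ n) (r : ℕ) :
    (n = 4 * r →
      (Even p → ((augmentedTokenGraph n p).indepNum : ℚ) = ((r : ℚ) + p / 2) * n) ∧
      (Odd p → ((augmentedTokenGraph n p).indepNum : ℚ) = ((r : ℚ) + p / 2) * n) ∧
      (p = 0 → (augmentedTokenGraph n p).indepNum = 4 * r ^ 2 ∧
        (augmentedTokenGraph n p).indepNum = n * (n / 2) / 2) ∧
      (p = 1 → (augmentedTokenGraph n p).indepNum = 4 * r ^ 2 + 2 * r ∧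
        (augmentedTokenGraph n p).indepNum = r * (n + 2))) ∧
    (n = 4 * r + 1 →
      (Even p → ((augmentedTokenGraph n p).indepNum : ℚ) = ((r : ℚ) + p / 2) * n) ∧
      (Odd p → ((augmentedTokenGraph n p).indepNum : ℚ) = ((r : ℚ) + p / 2) * n - 1 / 2) ∧
      (p = 0 → (augmentedTokenGraph n p).indepNum = 4 * r ^ 2 + r ∧
        (augmentedTokenGraph n p).indepNum = n * (n / 2) / 2) ∧
      (p = 1 → (augmentedTokenGraph n p).indepNum = 4 * r ^ 2 + 3 * r ∧
        (augmentedTokenGraph n p).indepNum = r * (n + 2))) ∧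
    (n = 4 * r + 2 →
      (Even p → ((augmentedTokenGraph n p).indepNum : ℚ) = ((r : ℚ) + p / 2 + 1 / 2) * n) ∧
      (Odd p → ((augmentedTokenGraph n p).indepNum : ℚ) = ((r : ℚ) + p / 2 + 1 / 2) * n) ∧
      (p = 0 → (augmentedTokenGraph n p).indepNum = (2 * r + 1) ^ 2 ∧
        (augmentedTokenGraph n p).indepNum = n * (n / 2) / 2) ∧
      (p = 1 → (augmentedTokenGraph n p).indepNum = 4 * r ^ 2 + 6 * r + 2 ∧
        (augmentedTokenGraph n p).indepNum = (r + 1) * n)) ∧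
    (n = 4 * r + 3 →
      (Even p →
        ((augmentedTokenGraph n p).indepNum : ℚ) = ((r : ℚ) + p / 2 + 1 / 2) * n - 1 / 2) ∧
      (Odd p → ((augmentedTokenGraph n p).indepNum : ℚ) = ((r : ℚ) + p / 2 + 1 / 2) * n) ∧
      (p = 0 → (augmentedTokenGraph n p).indepNum = 4 * r ^ 2 + 5 * r + 1 ∧
        (augmentedTokenGraph n p).indepNum = n * (n / 2) / 2) ∧
      (p = 1 → (augmentedTokenGraph n p).indepNum = 4 * r ^ 2 + 7 * r + 3 ∧
        (augmentedTokenGraph n p).indepNum = (r + 1) * n)) := by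

  rw [indepNum_augmentedTokenGraph n p hn]
  have cast_half : ∀ a b : ℕ, 2 * b = a → ((a / 2 : ℕ) : ℚ) = b := by
    intro a b h
    rw [← h, Nat.mul_div_cancel_left _ two_pos]
  refine ⟨?_, ?_, ?_, ?_⟩
  · rintro rfl
    rw [show 4 * r / 2 = 2 * r by omega]
    refine ⟨?_, ?_, ?_, ?_⟩
    · rintro ⟨s, rfl⟩
      rw [cast_half _ ((r + s) * (4 * r)) (by ring)]
      push_cast; ring
    · rintro ⟨s, rfl⟩
      rw [cast_half _ ((2 * r + (2 * s + 1)) * (2 * r)) (by ring)]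
      push_cast; ring
    · rintro rfl
      refine ⟨?_, by congr 1; ring⟩
      rw [show (2 * r + 0) * (4 * r) = 2 * (4 * r ^ 2) by ring]; omega
    · rintro rfl
      constructor
      · rw [show (2 * r + 1) * (4 * r) = 2 * (4 * r ^ 2 + 2 * r) by ring]; omega
      · rw [show (2 * r + 1) * (4 * r) = 2 * (r * (4 * r + 2)) by ring]; omega
  · rintro rfl
    rw [show (4 * r + 1) / 2 = 2 * r by omega]
    refine ⟨?_, ?_, ?_, ?_⟩
    · rintro ⟨s, rfl⟩
      rw [cast_half _ ((r + s) * (4 * r + 1)) (by ring)]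
      push_cast; ring
    · rintro ⟨s, rfl⟩
      -- Both `n` and the number of rows are odd, so rounding down costs `1 / 2`.
      rw [show (2 * r + (2 * s + 1)) * (4 * r + 1) / 2 = (r + s) * (4 * r + 1) + 2 * r by
        rw [show (2 * r + (2 * s + 1)) * (4 * r + 1) =
          2 * ((r + s) * (4 * r + 1)) + (4 * r + 1) by ring]; omega]
      push_cast; ring
    · rintro rfl
      refine ⟨?_, by congr 1; ring⟩
      rw [show (2 * r + 0) * (4 * r + 1) = 2 * (4 * r ^ 2 + r) by ring]; omega
    · rintro rfl
      constructor
      · rw [show (2 * r + 1) * (4 * r + 1) = 2 * (4 * r ^ 2 + 3 * r) + 1 by ring]; omega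
      · rw [show (2 * r + 1) * (4 * r + 1) = 2 * (r * (4 * r + 1 + 2)) + 1 by ring]; omega
  · rintro rfl
    rw [show (4 * r + 2) / 2 = 2 * r + 1 by omega]
    refine ⟨?_, ?_, ?_, ?_⟩
    · rintro ⟨s, rfl⟩
      rw [cast_half _ ((2 * r + 1 + (s + s)) * (2 * r + 1)) (by ring)]
      push_cast; ring
    · rintro ⟨s, rfl⟩
      rw [cast_half _ ((2 * r + 1 + (2 * s + 1)) * (2 * r + 1)) (by ring)]
      push_cast; ring
    · rintro rfl
      refine ⟨?_, by congr 1; ring⟩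
      rw [show (2 * r + 1 + 0) * (4 * r + 2) = 2 * (2 * r + 1) ^ 2 by ring]; omega
    · rintro rfl
      constructor
      · rw [show (2 * r + 1 + 1) * (4 * r + 2) = 2 * (4 * r ^ 2 + 6 * r + 2) by ring]; omega
      · rw [show (2 * r + 1 + 1) * (4 * r + 2) = 2 * ((r + 1) * (4 * r + 2)) by ring]; omega
  · rintro rfl
    rw [show (4 * r + 3) / 2 = 2 * r + 1 by omega]
    refine ⟨?_, ?_, ?_, ?_⟩
    · rintro ⟨s, rfl⟩
      rw [show (2 * r + 1 + (s + s)) * (4 * r + 3) / 2 = (r + s) * (4 * r + 3) + (2 * r + 1) by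
        rw [show (2 * r + 1 + (s + s)) * (4 * r + 3) =
          2 * ((r + s) * (4 * r + 3)) + (4 * r + 3) by ring]; omega]
      push_cast; ring
    · rintro ⟨s, rfl⟩
      rw [cast_half _ ((r + s + 1) * (4 * r + 3)) (by ring)]
      push_cast; ring
    · rintro rfl
      refine ⟨?_, by congr 1; ring⟩
      rw [show (2 * r + 1 + 0) * (4 * r + 3) = 2 * (4 * r ^ 2 + 5 * r + 1) + 1 by ring]; omega
    · rintro rfl
      constructor
      · rw [show (2 * r + 1 + 1) * (4 * r + 3) = 2 * (4 * r ^ 2 + 7 * r + 3) by ring]; omega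
      · rw [show (2 * r + 1 + 1) * (4 * r + 3) = 2 * ((r + 1) * (4 * r + 3)) by ring]; omega
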